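/- Let $M$ be a smooth ($C^\infty$) manifold (Hausdorff, second countable) of dimension $n \ge 1$. A Lorentzian metric $g$ on $M$ is a smooth field of symmetric bilinear forms on the tangent spaces of signature $(-,+,\dots,+)$. A time orientation of $(M,g)$ is an equivalence class of continuous vector fields $T$ with $g(T,T)<0$ everywhere, where $T$ and $T'$ are equivalent if $g(T,T')<0$ everywhere. A spacetime is a Lorentzian manifold $(M,g)$ together with a time orientation. A smooth Riemannian metric $h$ on $M$ is said to be adapted to $g$ if 1. for every point $p\in M$ there are a smooth coordinate chart $(x_1,\dots,x_n)$ around $p$ and a constant $\lambda>0$ such that, in these coordinates, $g$ at $p$ is $\lambda(-dx_1^2+dx_2^2+\dots+dx_n^2)$ and $h$ at $p$ is $dx_1^2+dx_2^2+\dots+dx_n^2$; and 2. $h$ is complete, i.e. every sequence in $M$ that is Cauchy for the Riemannian distance of $h$ converges for this distance (the distance between points that no path joins being $+\infty$). Proposition. For every spacetime $(M,g)$ there exists a Riemannian metric $h$ on $M$ that is adapted to $g$. -/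

import Mathlib

open scoped Manifold ContDiff Bundle Topology

noncomputable section

/-- The bilinear form of Minkowski's metric `-dx₀² + dx₁² + ⋯ + dx_d²` on `ℝ^(d+1)`
(the coordinate of index `0` is the time coordinate). -/
def minkowskiForm {d : ℕ} (v w : EuclideanSpace ℝ (Fin (d + 1))) : ℝ :=
  -(v 0 * w 0) + ∑ i : Fin d, v i.succ * w i.succ

/-- The bilinear form of the Euclidean metric `dx₀² + dx₁² + ⋯ + dx_d²` on `ℝ^(d+1)`. -/
def euclideanForm {d : ℕ} (v w : EuclideanSpace ℝ (Fin (d + 1))) : ℝ :=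
  ∑ i : Fin (d + 1), v i * w i

/-- A smooth Lorentzian metric on a smooth manifold `M` of dimension `d + 1`: a smooth field of
symmetric bilinear forms of signature `(-, +, …, +)` on the tangent spaces. -/
structure LorentzianMetric (d : ℕ) (M : Type*) [TopologicalSpace M]
    [ChartedSpace (EuclideanSpace ℝ (Fin (d + 1))) M] [IsManifold (𝓡 (d + 1)) ∞ M] where
  /-- The bilinear form on each tangent space. -/
  inner (p : M) : TangentSpace (𝓡 (d + 1)) p →L[ℝ] TangentSpace (𝓡 (d + 1)) p →L[ℝ] ℝ
  symm (p : M) (v w : TangentSpace (𝓡 (d + 1)) p) : inner p v w = inner p w v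
  /-- The signature is `(-, +, …, +)`: some orthogonal basis has its first vector negative and all
  the others positive. -/
  signature (p : M) : ∃ b : Module.Basis (Fin (d + 1)) ℝ (TangentSpace (𝓡 (d + 1)) p),
    (∀ i j, i ≠ j → inner p (b i) (b j) = 0) ∧ inner p (b 0) (b 0) < 0 ∧
      ∀ i : Fin d, 0 < inner p (b i.succ) (b i.succ)
  contMDiff : ContMDiff (𝓡 (d + 1))
    ((𝓡 (d + 1)).prod 𝓘(ℝ, EuclideanSpace ℝ (Fin (d + 1)) →L[ℝ]
      EuclideanSpace ℝ (Fin (d + 1)) →L[ℝ] ℝ)) ∞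
    (fun p ↦ Bundle.TotalSpace.mk' (EuclideanSpace ℝ (Fin (d + 1)) →L[ℝ]
      EuclideanSpace ℝ (Fin (d + 1)) →L[ℝ] ℝ) p (inner p))

/-- A smooth Riemannian metric on a smooth manifold `M` of dimension `d + 1`. -/
abbrev SmoothRiemannianMetric (d : ℕ) (M : Type*) [TopologicalSpace M]
    [ChartedSpace (EuclideanSpace ℝ (Fin (d + 1))) M] [IsManifold (𝓡 (d + 1)) ∞ M] :=
  Bundle.ContMDiffRiemannianMetric (𝓡 (d + 1)) ∞ (EuclideanSpace ℝ (Fin (d + 1)))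
    (fun p : M ↦ TangentSpace (𝓡 (d + 1)) p)

section

variable {d : ℕ} {M : Type*} [TopologicalSpace M]
  [ChartedSpace (EuclideanSpace ℝ (Fin (d + 1))) M] [IsManifold (𝓡 (d + 1)) ∞ M]

/-- A continuous vector field that is timelike for `g` at every point. -/
structure TimelikeField (g : LorentzianMetric d M) where
  /-- The value of the vector field at each point. -/
  toFun (p : M) : TangentSpace (𝓡 (d + 1)) p
  continuous : Continuous
    (fun p ↦ (⟨p, toFun p⟩ : TangentBundle (𝓡 (d + 1)) M))
  timelike (p : M) : g.inner p (toFun p) (toFun p) < 0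

/-- A time orientation of `(M, g)`: a class of everywhere timelike continuous vector fields for the
equivalence relation `g(T, T') < 0` everywhere. A Lorentzian manifold with a time orientation is a
spacetime. -/
structure TimeOrientation (g : LorentzianMetric d M) where
  /-- The vector fields in the class. -/
  carrier : Set (TimelikeField g)
  isClass : ∃ T : TimelikeField g,
    carrier = {T' : TimelikeField g | ∀ p, g.inner p (T.toFun p) (T'.toFun p) < 0}

/-- The Riemannian distance of `h`: the infimum of the `h`-lengths of the `C^1` paths joining two
points (it is `∞` when there is no such path). -/
def SmoothRiemannianMetric.edist (h : SmoothRiemannianMetric d M) (x y : M) : ENNReal :=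
  letI : Bundle.RiemannianBundle (fun p : M ↦ TangentSpace (𝓡 (d + 1)) p) :=
    ⟨h.toRiemannianMetric⟩
  Manifold.riemannianEDist (𝓡 (d + 1)) x y

/-- `h` is complete: every Cauchy sequence for the Riemannian distance converges. -/
def SmoothRiemannianMetric.IsComplete (h : SmoothRiemannianMetric d M) : Prop :=
  ∀ u : ℕ → M,
    (∀ ε : ENNReal, 0 < ε → ∃ N : ℕ, ∀ m ≥ N, ∀ n ≥ N,
      SmoothRiemannianMetric.edist h (u m) (u n) < ε) →
    ∃ x : M, Filter.Tendsto (fun n ↦ SmoothRiemannianMetric.edist h (u n) x) Filter.atTop (𝓝 0)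

/-- `h` is adapted to `g`: around every point `p` there are a smooth chart `φ` and a constant
`c > 0` such that, in the coordinates given by `φ`, `g` at `p` is `c` times Minkowski's metric and
`h` at `p` is the Euclidean metric; and `h` is complete. -/
structure IsAdapted (g : LorentzianMetric d M) (h : SmoothRiemannianMetric d M) : Prop where
  exists_chart : ∀ p : M, ∃ φ ∈ IsManifold.maximalAtlas (𝓡 (d + 1)) ∞ M, p ∈ φ.source ∧
    ∃ c : ℝ, 0 < c ∧ ∀ v w : TangentSpace (𝓡 (d + 1)) p,
      g.inner p v w = c * minkowskiForm
        (mfderiv (𝓡 (d + 1)) 𝓘(ℝ, EuclideanSpace ℝ (Fin (d + 1))) φ p v)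
        (mfderiv (𝓡 (d + 1)) 𝓘(ℝ, EuclideanSpace ℝ (Fin (d + 1))) φ p w) ∧
      h.inner p v w = euclideanForm
        (mfderiv (𝓡 (d + 1)) 𝓘(ℝ, EuclideanSpace ℝ (Fin (d + 1))) φ p v)
        (mfderiv (𝓡 (d + 1)) 𝓘(ℝ, EuclideanSpace ℝ (Fin (d + 1))) φ p w)
  complete : SmoothRiemannianMetric.IsComplete h

end

end

/-! Let `X` be a smooth timelike field. Since the `g`-orthogonal of `X` is spacelike, reversing the
sign of `g` on the line of `X`, that is, taking `g - (2 / g(X,X)) g(X,·) ⊗ g(X,·)`, gives a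
Riemannian metric `h₀`. An `h₀`-orthonormal basis starting along `X` diagonalizes both forms, and as
the condition on charts concerns one point at a time, a linear change of any chart realizes it. The
time orientation supplies a timelike field `T` that is only continuous; timelike vectors in the half
cone of `T` form a convex set, so a partition of unity yields `X`.

The free constant `λ` makes the chart condition insensitive to a positive factor `f`, which can be
spent on completeness. Take a smooth exhaustion `ρ` and `f` with `(dρ)² ≤ f h₀`. Then `ρ` is
`1`-Lipschitz for `f h₀`, so a Cauchy sequence eventually stays in a compact set and converges. -/

noncomputable section

/-! ### Linear algebra of Lorentzian forms -/

section LinearAlgebra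

variable {V : Type*} [AddCommGroup V] [Module ℝ V] {d : ℕ}

/-- A bilinear form of signature `(-, +, …, +)`. -/
structure IsLorentzForm (d : ℕ) (B : V →ₗ[ℝ] V →ₗ[ℝ] ℝ) : Prop where
  symm : ∀ v w, B v w = B w v
  signature : ∃ b : Module.Basis (Fin (d + 1)) ℝ V,
    (∀ i j, i ≠ j → B (b i) (b j) = 0) ∧ B (b 0) (b 0) < 0 ∧ ∀ i : Fin d, 0 < B (b i.succ) (b i.succ)

variable {B : V →ₗ[ℝ] V →ₗ[ℝ] ℝ}

theorem apply_self_eq_sum_of_orthogonal_basis {ι : Type*} [Fintype ι] (b : Module.Basis ι ℝ V)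
    (hb : ∀ i j, i ≠ j → B (b i) (b j) = 0) (u : V) :
    B u u = ∑ i, b.repr u i ^ 2 * B (b i) (b i) := by
  classical
  conv_lhs => rw [← b.sum_repr u]
  simp only [map_sum, LinearMap.sum_apply, map_smul, LinearMap.smul_apply, smul_eq_mul]
  refine Finset.sum_congr rfl fun i _ ↦ ?_
  rw [Finset.sum_eq_single i]
  · ring
  · intro j _ hj
    rw [hb j i hj]; ring
  · simp

namespace IsLorentzForm

/-- The orthogonal of a timelike vector is spacelike. -/
theorem pos_of_orthogonal (hB : IsLorentzForm d B) {T v : V} (hT : B T T < 0) (hv : B T v = 0)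
    (hv0 : v ≠ 0) : 0 < B v v := by
  obtain ⟨b, hb, -, hpos⟩ := hB.signature
  have key : ∀ u, b.repr u 0 = 0 → u ≠ 0 → 0 < B u u := by
    intro u hu hu0
    rw [apply_self_eq_sum_of_orthogonal_basis b hb, Fin.sum_univ_succ, hu]
    obtain ⟨i, hi⟩ : ∃ i : Fin d, b.repr u i.succ ≠ 0 := by
      by_contra! H
      apply hu0
      apply b.ext_elem
      intro i
      refine Fin.cases ?_ ?_ i
      · simpa using hu
      · simpa using H
    have : 0 < ∑ i : Fin d, b.repr u i.succ ^ 2 * B (b i.succ) (b i.succ) :=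
      Finset.sum_pos' (fun j _ ↦ mul_nonneg (sq_nonneg _) (hpos j).le)
        ⟨i, Finset.mem_univ _, mul_pos (by positivity) (hpos i)⟩
    simpa using this
  by_contra! hneg
  have hT0 : b.repr T 0 ≠ 0 := fun h ↦ by
    have : T ≠ 0 := by rintro rfl; simp at hT
    linarith [key T h this]
  -- This combination cancels the `0`-th coordinate, so it lies where `B` is positive definite; but
  -- `B u u ≤ 0`, which forces `u = 0`.
  set u : V := b.repr v 0 • T - b.repr T 0 • v with hu
  have hBu : B u u = b.repr v 0 ^ 2 * B T T + b.repr T 0 ^ 2 * B v v := by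
    have hv' : B v T = 0 := by rw [hB.symm, hv]
    simp [hu, hv, hv']
    ring
  have hu0 : b.repr u 0 = 0 := by simp [hu]; ring
  have hle : B u u ≤ 0 := by
    rw [hBu]
    nlinarith [sq_nonneg (b.repr v 0), sq_nonneg (b.repr T 0)]
  have hu' : u = 0 := by
    by_contra h
    linarith [key u hu0 h]
  have hz : b.repr v 0 = 0 := by
    rw [hu'] at hBu
    simp only [map_zero] at hBu
    by_contra h
    have : 0 < b.repr v 0 ^ 2 := by positivity
    nlinarith [sq_nonneg (b.repr T 0)]
  exact absurd (key v hz hv0) (not_lt.2 hneg)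

/-- Two timelike vectors in the same half of the light cone have negative product. -/
theorem neg_of_mem_cone (hB : IsLorentzForm d B) {T v w : V} (hT : B T T < 0)
    (hTv : B T v < 0) (hv : B v v < 0) (hTw : B T w < 0) (hw : B w w < 0) : B v w < 0 := by
  by_contra! h
  -- `u` is orthogonal to `T`, hence spacelike or zero, yet `0 ≤ B v w` would make it timelike.
  set u : V := B T w • v - B T v • w with hu
  have hTu : B T u = 0 := by simp [hu]; ring
  have hBu : B u u = B T w ^ 2 * B v v - 2 * (B T w * B T v) * B v w + B T v ^ 2 * B w w := by
    simp [hu, hB.symm w v]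
    ring
  have hneg : B u u < 0 := by
    have h1 : B T w ^ 2 * B v v < 0 := mul_neg_of_pos_of_neg (sq_pos_of_neg hTw) hv
    have h2 : B T v ^ 2 * B w w < 0 := mul_neg_of_pos_of_neg (sq_pos_of_neg hTv) hw
    have h3 := mul_nonneg (mul_pos_of_neg_of_neg hTw hTv).le h
    linarith
  have hu0 : u ≠ 0 := fun h0 ↦ by simp [h0] at hneg
  linarith [hB.pos_of_orthogonal hT hTu hu0]

/-- The cross term of the quadratic form is negative by `neg_of_mem_cone`. Convexity is what allows
gluing by partitions of unity. -/
theorem convex_cone (hB : IsLorentzForm d B) {T : V} (hT : B T T < 0) :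
    Convex ℝ {v | B T v < 0 ∧ B v v < 0} := by
  rintro v ⟨hTv, hv⟩ w ⟨hTw, hw⟩ a c ha hc hac
  have hvw := hB.neg_of_mem_cone hT hTv hv hTw hw
  rcases ha.eq_or_lt with rfl | ha
  · have : c = 1 := by linarith
    subst this
    simpa using ⟨hTw, hw⟩
  constructor
  · have h1 := mul_neg_of_pos_of_neg ha hTv
    have h2 := mul_nonpos_of_nonneg_of_nonpos hc hTw.le
    simp only [map_add, map_smul, smul_eq_mul]
    linarith
  · have h1 := mul_neg_of_pos_of_neg (mul_pos ha ha) hv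
    have h2 := mul_nonpos_of_nonneg_of_nonpos (mul_nonneg hc hc) hw.le
    have h3 := mul_nonpos_of_nonneg_of_nonpos (mul_nonneg ha.le hc) hvw.le
    simp only [map_add, map_smul, smul_eq_mul, LinearMap.add_apply, LinearMap.smul_apply,
      hB.symm w v]
    linarith

/-- Flipping the sign of a Lorentzian form along a timelike vector gives a definite form. -/
theorem flip_pos (hB : IsLorentzForm d B) {X v : V} (hX : B X X < 0) (hv : v ≠ 0) :
    0 < B v v - 2 / B X X * (B X v * B X v) := by
  -- With `a • X` the `B`-orthogonal projection of `v`, the flipped form is `B u u - a ^ 2 * B X X`,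
  -- a sum of nonnegative terms that do not both vanish.
  set a : ℝ := B X v / B X X with ha
  set u : V := v - a • X with hu
  have haX : a * B X X = B X v := div_mul_cancel₀ _ hX.ne
  have hXu : B X u = 0 := by simp [hu, haX]
  have hBu : B u u = B v v - a ^ 2 * B X X := by
    simp only [hu, map_sub, map_smul, LinearMap.sub_apply, LinearMap.smul_apply, smul_eq_mul,
      hB.symm v X, ← haX]
    ring
  have heq : B v v - 2 / B X X * (B X v * B X v) = B u u - a ^ 2 * B X X := by
    rw [hBu, ← haX]
    field_simp [hX.ne]
    ring
  rw [heq]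
  by_cases hu0 : u = 0
  · have ha0 : a ≠ 0 := by
      intro h
      rw [h, zero_smul, sub_zero] at hu
      exact hv (hu ▸ hu0)
    have : 0 < a ^ 2 := by positivity
    simp only [hu0, map_zero]
    nlinarith
  · nlinarith [hB.pos_of_orthogonal hX hXu hu0, sq_nonneg a]

end IsLorentzForm

/-- Orthonormal coordinates for a positive definite form whose first axis is a given direction. -/
theorem exists_orthonormal_coordinates [FiniteDimensional ℝ V]
    (hd : Module.finrank ℝ V = d + 1) {H : V →ₗ[ℝ] V →ₗ[ℝ] ℝ}
    (hsymm : ∀ v w, H v w = H w v) (hpos : ∀ v, v ≠ 0 → 0 < H v v) {X : V} (hX : X ≠ 0) :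
    ∃ A : V ≃ₗ[ℝ] EuclideanSpace ℝ (Fin (d + 1)),
      (∀ v w, H v w = ∑ i, A v i * A w i) ∧ ∀ v, A v 0 = H X v / √(H X X) := by
  let core : InnerProductSpace.Core ℝ V :=
    { inner v w := H v w
      conj_inner_symm v w := hsymm w v
      re_inner_nonneg v := by
        rcases eq_or_ne v 0 with rfl | hv
        · simp
        · exact (hpos v hv).le
      add_left v w x := by simp
      smul_left c v := by simp
      definite v h := by
        by_contra hv
        exact (hpos v hv).ne' h }
  let : NormedAddCommGroup V := core.toNormedAddCommGroup
  let : InnerProductSpace ℝ V := .ofCore core.toCore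
  have hin : ∀ v w : V, inner ℝ v w = H v w := fun _ _ ↦ rfl
  have hr : 0 < √(H X X) := Real.sqrt_pos.2 (hpos X hX)
  have hortho : Orthonormal ℝ
      (({0} : Set (Fin (d + 1))).domRestrict fun _ ↦ (√(H X X))⁻¹ • X) := by
    constructor
    · intro i
      have hn : ‖X‖ = √(H X X) := by rw [norm_eq_sqrt_real_inner, hin]
      change ‖(√(H X X))⁻¹ • X‖ = 1
      rw [norm_smul, hn, norm_inv, Real.norm_of_nonneg hr.le, inv_mul_cancel₀ hr.ne']
    · rintro ⟨i, rfl⟩ ⟨j, rfl⟩ hij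
      exact absurd rfl hij
  obtain ⟨b, hb⟩ := hortho.exists_orthonormalBasis_extension_of_card_eq (by simpa using hd)
  refine ⟨b.repr.toLinearEquiv, fun v w ↦ ?_, fun v ↦ ?_⟩
  · rw [← hin, ← b.sum_inner_mul_inner]
    refine Finset.sum_congr rfl fun i _ ↦ ?_
    simp [b.repr_apply_apply, real_inner_comm]
  · have := hb 0 rfl
    simp only [LinearIsometryEquiv.coe_toLinearEquiv, b.repr_apply_apply, this, hin, map_smul,
      LinearMap.smul_apply, smul_eq_mul]
    field_simp

end LinearAlgebra

/-- The unit ball of a positive definite form on a finite dimensional space is bounded. -/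
theorem isVonNBounded_of_pos {F : Type*} [NormedAddCommGroup F] [NormedSpace ℝ F]
    [FiniteDimensional ℝ F] (H : F →L[ℝ] F →L[ℝ] ℝ) (hpos : ∀ v, v ≠ 0 → 0 < H v v) :
    Bornology.IsVonNBounded ℝ {v : F | H v v < 1} := by
  have hcont : Continuous fun v ↦ H v v := by fun_prop
  obtain ⟨c, hc, hle⟩ : ∃ c > 0, ∀ v ∈ Metric.sphere (0 : F) 1, c ≤ H v v := by
    refine (isCompact_sphere (0 : F) 1).exists_forall_le' hcont.continuousOn fun v hv ↦ hpos v ?_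
    rintro rfl
    simp at hv
  have hbound : ∀ v : F, c * ‖v‖ ^ 2 ≤ H v v := by
    intro v
    rcases eq_or_ne v 0 with rfl | hv
    · simp
    have hn : 0 < ‖v‖ := norm_pos_iff.2 hv
    have := hle (‖v‖⁻¹ • v) (by simp [norm_smul, hn.ne'])
    simp only [map_smul, smul_apply, smul_eq_mul] at this
    calc c * ‖v‖ ^ 2 ≤ ‖v‖⁻¹ * (‖v‖⁻¹ * H v v) * ‖v‖ ^ 2 := by gcongr
      _ = H v v := by field_simp
  rw [NormedSpace.isVonNBounded_iff]
  -- Outside this ball `‖v‖ ^ 2 ≥ ‖v‖ ≥ 1 + c⁻¹`, so `c * ‖v‖ ^ 2 > 1`; no square root is needed.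
  refine (Metric.isBounded_ball (x := (0 : F)) (r := 1 + c⁻¹)).subset fun v hv ↦ ?_
  have hv' : c * ‖v‖ ^ 2 < 1 := (hbound v).trans_lt hv
  rw [mem_ball_zero_iff]
  by_contra! h
  have hci : c * c⁻¹ = 1 := mul_inv_cancel₀ hc.ne'
  have h1 : 1 + c⁻¹ ≤ ‖v‖ ^ 2 := by
    have : (1:ℝ) ≤ ‖v‖ := by linarith [inv_pos.2 hc]
    nlinarith
  nlinarith

/-! ### Smooth tensor fields -/

section Smoothness

open Bundle

variable {EB : Type*} [NormedAddCommGroup EB] [NormedSpace ℝ EB]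
  {HB : Type*} [TopologicalSpace HB] {IB : ModelWithCorners ℝ EB HB} {n : WithTop ℕ∞}
  {B : Type*} [TopologicalSpace B] [ChartedSpace HB B]
  {F : Type*} [NormedAddCommGroup F] [NormedSpace ℝ F]
  {E : B → Type*} [TopologicalSpace (TotalSpace F E)] [∀ x, AddCommGroup (E x)]
  [∀ x, Module ℝ (E x)] [∀ x, TopologicalSpace (E x)]
  [FiberBundle F E] [VectorBundle ℝ F E]

set_option synthInstance.maxHeartbeats 200000 in
/-- The tensor square of a smooth field of linear forms is smooth. -/
theorem ContMDiff.smulRight_self_bundle {α : ∀ x, E x →L[ℝ] ℝ}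
    (hα : ContMDiff IB (IB.prod 𝓘(ℝ, F →L[ℝ] ℝ)) n
      (fun x ↦ TotalSpace.mk' (F →L[ℝ] ℝ) (E := fun x ↦ E x →L[ℝ] ℝ) x (α x))) :
    ContMDiff IB (IB.prod 𝓘(ℝ, F →L[ℝ] F →L[ℝ] ℝ)) n
      (fun x ↦ TotalSpace.mk' (F →L[ℝ] F →L[ℝ] ℝ) (E := fun x ↦ E x →L[ℝ] E x →L[ℝ] ℝ) x
        ((α x).smulRight (α x))) := by
  intro x₀
  have h := (contMDiffAt_hom_bundle (E₂ := Bundle.Trivial B ℝ) _).1 (hα x₀)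
  refine (contMDiffAt_hom_bundle (E₂ := fun x ↦ E x →L[ℝ] ℝ) _).2 ⟨h.1, ?_⟩
  -- In a trivialization, the field is this fixed smooth map applied to the coordinates of `α`.
  have hsq : ContDiff ℝ n fun a : F →L[ℝ] ℝ ↦ a.smulRight a := contDiff_id.smulRight contDiff_id
  refine (hsq.contMDiff.contMDiffAt.comp x₀ h.2).congr_of_eventuallyEq ?_
  filter_upwards [(trivializationAt F E x₀).open_baseSet.mem_nhds
    (FiberBundle.mem_baseSet_trivializationAt' x₀)] with x hx
  ext v w
  have hmem : x ∈ (trivializationAt (F →L[ℝ] ℝ) (fun x ↦ E x →L[ℝ] ℝ) x₀).baseSet := by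
    simpa using hx
  have hlin : Trivialization.linearMapAt ℝ
      (trivializationAt (F →L[ℝ] ℝ) (fun x ↦ E x →L[ℝ] ℝ) x₀) x (α x) w =
      α x (Trivialization.symmL ℝ (trivializationAt F E x₀) x w) := by
    rw [Trivialization.linearMapAt_apply, if_pos hmem, hom_trivializationAt_apply]
    simp [ContinuousLinearMap.inCoordinates]
  simp [ContinuousLinearMap.inCoordinates, hlin]

end Smoothness

variable {d : ℕ} {M : Type*} [TopologicalSpace M]
  [ChartedSpace (EuclideanSpace ℝ (Fin (d + 1))) M] [IsManifold (𝓡 (d + 1)) ∞ M]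

/-! ### Smooth timelike fields -/

namespace LorentzianMetric

/-- The metric at a point, as a bilinear form. -/
def form (g : LorentzianMetric d M) (p : M) :
    TangentSpace (𝓡 (d + 1)) p →ₗ[ℝ] TangentSpace (𝓡 (d + 1)) p →ₗ[ℝ] ℝ :=
  (ContinuousLinearMap.coeLM ℝ).comp (g.inner p).toLinearMap

theorem isLorentzForm (g : LorentzianMetric d M) (p : M) : IsLorentzForm d (g.form p) :=
  ⟨g.symm p, g.signature p⟩

/-- Near `x₀`, a smooth extension of `T x₀` stays in the open half cone of `T` by continuity; such
local sections glue because the half cones are convex. -/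
theorem exists_contMDiff_timelike [T2Space M] [SigmaCompactSpace M] (g : LorentzianMetric d M)
    (T : TimelikeField g) :
    ∃ X : ∀ p : M, TangentSpace (𝓡 (d + 1)) p,
      ContMDiff (𝓡 (d + 1)) (𝓡 (d + 1)).tangent ∞
        (fun p ↦ (⟨p, X p⟩ : TangentBundle (𝓡 (d + 1)) M)) ∧ ∀ p, g.inner p (X p) (X p) < 0 := by
  obtain ⟨s, hs⟩ := exists_contMDiffSection_forall_mem_convex_of_local (n := ⊤) (𝓡 (d + 1))
    (F_fiber := EuclideanSpace ℝ (Fin (d + 1)))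
    (fun p : M ↦ TangentSpace (𝓡 (d + 1)) p)
    (fun p ↦ {v | g.inner p (T.toFun p) v < 0 ∧ g.inner p v v < 0})
    (fun p ↦ (g.isLorentzForm p).convex_cone (T.timelike p)) fun x₀ ↦ by
      have hext : ContMDiffAt (𝓡 (d + 1)) (𝓡 (d + 1)).tangent ∞ (fun p ↦ (⟨p, FiberBundle.extend
        (EuclideanSpace ℝ (Fin (d + 1))) (T.toFun x₀) p⟩ : TangentBundle (𝓡 (d + 1)) M)) x₀ :=
        FiberBundle.contMDiffAt_extend ..
      have hT0 : ContMDiffAt (𝓡 (d + 1)) (𝓡 (d + 1)).tangent 0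
          (fun p ↦ (⟨p, T.toFun p⟩ : TangentBundle (𝓡 (d + 1)) M)) x₀ :=
        (contMDiff_zero_iff.2 T.continuous) x₀
      have hg0 := (g.contMDiff.of_le (m := 0) (by simp)) x₀
      have h1 : ContinuousAt (fun p ↦ g.inner p (T.toFun p) (FiberBundle.extend
          (EuclideanSpace ℝ (Fin (d + 1))) (T.toFun x₀) p)) x₀ :=
        ((Bundle.contMDiffAt_section _).1 (ContMDiffAt.clm_bundle_apply₂ (E₃ := Bundle.Trivial M ℝ)
          hg0 hT0 (hext.of_le (by simp)))).continuousAt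
      have h2 : ContinuousAt (fun p ↦ g.inner p (FiberBundle.extend
          (EuclideanSpace ℝ (Fin (d + 1))) (T.toFun x₀) p) (FiberBundle.extend
          (EuclideanSpace ℝ (Fin (d + 1))) (T.toFun x₀) p)) x₀ :=
        ((Bundle.contMDiffAt_section _).1 (ContMDiffAt.clm_bundle_apply₂ (E₃ := Bundle.Trivial M ℝ)
          hg0 (hext.of_le (by simp)) (hext.of_le (by simp)))).continuousAt
      obtain ⟨U, hU, hUs⟩ := FiberBundle.exists_contMDiffOn_extend (I := 𝓡 (d + 1)) (k := ∞)
        (EuclideanSpace ℝ (Fin (d + 1))) (T.toFun x₀)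
      have e1 := h1.eventually_lt continuousAt_const
        (by simpa using T.timelike x₀ : _ < (0 : ℝ))
      have e2 := h2.eventually_lt continuousAt_const
        (by simpa using T.timelike x₀ : _ < (0 : ℝ))
      exact ⟨_, Filter.inter_mem hU (Filter.inter_mem e1 e2), _,
        hUs.mono Set.inter_subset_left, fun y hy ↦ hy.2⟩
  exact ⟨s, s.contMDiff, fun p ↦ (hs p).2⟩

end LorentzianMetric

/-! ### Flipped and conformal metrics -/

/-- A smooth field of positive definite symmetric bilinear forms is a Riemannian metric. -/
def SmoothRiemannianMetric.ofPos
    (B : ∀ p : M, TangentSpace (𝓡 (d + 1)) p →L[ℝ] TangentSpace (𝓡 (d + 1)) p →L[ℝ] ℝ)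
    (symm : ∀ p v w, B p v w = B p w v) (pos : ∀ p v, v ≠ 0 → 0 < B p v v)
    (hB : ContMDiff (𝓡 (d + 1))
    ((𝓡 (d + 1)).prod 𝓘(ℝ, EuclideanSpace ℝ (Fin (d + 1)) →L[ℝ]
      EuclideanSpace ℝ (Fin (d + 1)) →L[ℝ] ℝ)) ∞
    (fun p ↦ Bundle.TotalSpace.mk' (EuclideanSpace ℝ (Fin (d + 1)) →L[ℝ]
      EuclideanSpace ℝ (Fin (d + 1)) →L[ℝ] ℝ) p (B p))) : SmoothRiemannianMetric d M where
  inner := B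
  symm := symm
  pos := pos
  isVonNBounded p := isVonNBounded_of_pos (F := EuclideanSpace ℝ (Fin (d + 1))) (B p) (pos p)
  contMDiff := hB

set_option synthInstance.maxHeartbeats 200000 in
/-- A Riemannian metric multiplied by a positive function. -/
def SmoothRiemannianMetric.conformal (h : SmoothRiemannianMetric d M) (f : M → ℝ)
    (hf : ContMDiff (𝓡 (d + 1)) 𝓘(ℝ) ∞ f) (hpos : ∀ p, 0 < f p) : SmoothRiemannianMetric d M :=
  .ofPos (fun p ↦ f p • h.inner p) (fun p v w ↦ congrArg (f p * ·) (h.symm p v w))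
    (fun p v hv ↦ mul_pos (hpos p) (h.pos p v hv)) (hf.smul_section h.contMDiff)

set_option synthInstance.maxHeartbeats 200000 in
/-- The metric `g` with its sign flipped along a timelike vector field. -/
def LorentzianMetric.flip (g : LorentzianMetric d M) (X : ∀ p : M, TangentSpace (𝓡 (d + 1)) p)
    (hX : ContMDiff (𝓡 (d + 1)) (𝓡 (d + 1)).tangent ∞
        (fun p ↦ (⟨p, X p⟩ : TangentBundle (𝓡 (d + 1)) M)))
    (hneg : ∀ p, g.inner p (X p) (X p) < 0) : SmoothRiemannianMetric d M :=
  .ofPos (fun p ↦ g.inner p - (2 / g.inner p (X p) (X p)) •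
      (g.inner p (X p)).smulRight (g.inner p (X p)))
    (fun p v w ↦ by
      change g.inner p v w - _ * (g.inner p (X p) v * g.inner p (X p) w) =
        g.inner p w v - _ * (g.inner p (X p) w * g.inner p (X p) v)
      rw [g.symm p v w, mul_comm (g.inner p (X p) v)])
    (fun p v hv ↦ (g.isLorentzForm p).flip_pos (hneg p) hv) <| by
    have h1 : ContMDiff (𝓡 (d + 1)) ((𝓡 (d + 1)).prod 𝓘(ℝ, EuclideanSpace ℝ (Fin (d + 1)) →L[ℝ] ℝ))
        ∞ (fun p ↦ Bundle.TotalSpace.mk' (EuclideanSpace ℝ (Fin (d + 1)) →L[ℝ] ℝ)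
        (E := fun p ↦ TangentSpace (𝓡 (d + 1)) p →L[ℝ] ℝ) p (g.inner p (X p))) :=
      ContMDiff.clm_bundle_apply g.contMDiff hX
    have h2 : ContMDiff (𝓡 (d + 1)) 𝓘(ℝ) ∞ (fun p ↦ g.inner p (X p) (X p)) := by
      have := ContMDiff.clm_bundle_apply (E₂ := Bundle.Trivial M ℝ) h1 hX
      exact fun p ↦ ((Bundle.contMDiffAt_section _).1 (this p))
    have h3 : ContMDiff (𝓡 (d + 1)) 𝓘(ℝ) ∞ (fun p ↦ 2 / g.inner p (X p) (X p)) :=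
      contMDiff_const.div₀ h2 fun p ↦ (hneg p).ne
    exact g.contMDiff.sub_section (h3.smul_section h1.smulRight_self_bundle)

/-- The differential of a real function, as a linear form on each tangent space. -/
def differential (ρ : M → ℝ) (p : M) : TangentSpace (𝓡 (d + 1)) p →L[ℝ] ℝ :=
  mfderiv (𝓡 (d + 1)) 𝓘(ℝ) ρ p

/-! ### Completeness by a conformal change -/

namespace SmoothRiemannianMetric

/-- The Riemannian bundle structure on the tangent bundle given by a metric. -/
@[reducible] def riemannianBundle (h : SmoothRiemannianMetric d M) :
    Bundle.RiemannianBundle (fun p : M ↦ TangentSpace (𝓡 (d + 1)) p) :=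
  ⟨h.toRiemannianMetric⟩

theorem isContinuousRiemannianBundle (h : SmoothRiemannianMetric d M) :
    let := riemannianBundle h
    IsContinuousRiemannianBundle (EuclideanSpace ℝ (Fin (d + 1)))
      (fun p : M ↦ TangentSpace (𝓡 (d + 1)) p) :=
  let := riemannianBundle h
  ⟨⟨h.inner, h.contMDiff.continuous, fun _ _ _ ↦ rfl⟩⟩

/-- If `(dρ)² ≤ h`, then `ρ` is `1`-Lipschitz for the Riemannian distance. -/
theorem enorm_sub_le_edist (h : SmoothRiemannianMetric d M) {ρ : M → ℝ}
    (hρ : ContMDiff (𝓡 (d + 1)) 𝓘(ℝ) 1 ρ)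
    (hle : ∀ p (v : TangentSpace (𝓡 (d + 1)) p),
      differential ρ p v ^ 2 ≤ h.inner p v v) (x y : M) :
    ‖ρ y - ρ x‖ₑ ≤ SmoothRiemannianMetric.edist h x y := by
  let := riemannianBundle h
  change _ ≤ Manifold.riemannianEDist (𝓡 (d + 1)) x y
  refine le_of_forall_gt fun r hr ↦ ?_
  obtain ⟨γ, hγ0, hγ1, hγ, hlen⟩ := Manifold.exists_lt_of_riemannianEDist_lt hr
  refine lt_of_le_of_lt ?_ hlen
  have hcomp : ContDiffOn ℝ 1 (ρ ∘ γ) (Set.Icc 0 1) :=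
    contMDiffOn_iff_contDiffOn.1 (hρ.comp_contMDiffOn hγ)
  -- The variation of `ρ` along `γ` is at most `∫ |(ρ ∘ γ)'|`, and `|dρ(γ')| ≤ ‖γ'‖` pointwise.
  rw [← hγ0, ← hγ1, Manifold.pathELength_eq_lintegral_mfderivWithin_Icc]
  refine (enorm_sub_le_lintegral_derivWithin_Icc_of_contDiffOn_Icc hcomp zero_le_one).trans ?_
  refine MeasureTheory.setLIntegral_mono' measurableSet_Icc fun t ht ↦ ?_
  set v := mfderivWithin 𝓘(ℝ) (𝓡 (d + 1)) γ (Set.Icc 0 1) t 1 with hv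
  have hder : derivWithin (ρ ∘ γ) (Set.Icc 0 1) t = differential ρ (γ t) v := by
    have := mfderiv_comp_mfderivWithin (I := 𝓘(ℝ)) (I' := 𝓡 (d + 1)) (I'' := 𝓘(ℝ)) (f := γ)
      (g := ρ) (s := Set.Icc 0 1) t
      ((hρ.mdifferentiable one_ne_zero) (γ t)) (hγ.mdifferentiableOn one_ne_zero t ht)
      (uniqueMDiffWithinAt_iff_uniqueDiffWithinAt.2 (uniqueDiffOn_Icc zero_lt_one t ht))
    rw [← fderivWithin_derivWithin, ← mfderivWithin_eq_fderivWithin, this]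
    rfl
  rw [hder]
  have hnorm : ‖v‖ ^ 2 = h.inner (γ t) v v := (real_inner_self_eq_norm_sq v).symm
  have hreal : ‖differential ρ (γ t) v‖ ≤ ‖v‖ := by
    rw [Real.norm_eq_abs]
    exact abs_le_of_sq_le_sq (by rw [hnorm]; exact hle _ _) (norm_nonneg v)
  exact enorm_le_iff_norm_le.2 hreal

/-- A metric dominating the squared differential of a proper function is complete. -/
theorem isComplete_of_proper (h : SmoothRiemannianMetric d M) {ρ : M → ℝ}
    (hρ : ContMDiff (𝓡 (d + 1)) 𝓘(ℝ) 1 ρ)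
    (hle : ∀ p (v : TangentSpace (𝓡 (d + 1)) p),
      differential ρ p v ^ 2 ≤ h.inner p v v)
    (hproper : ∀ R : ℝ, ∃ K : Set M, IsCompact K ∧ {x | ρ x ≤ R} ⊆ K) :
    SmoothRiemannianMetric.IsComplete h := by
  intro u hu
  let := riemannianBundle h
  have := isContinuousRiemannianBundle h
  obtain ⟨N, hN⟩ := hu 1 one_pos
  obtain ⟨K, hK, hsub⟩ := hproper (ρ (u N) + 1)
  have hmem : ∀ n ≥ N, u n ∈ K := fun n hn ↦ by
    have h1 := (enorm_sub_le_edist h hρ hle (u N) (u n)).trans_lt (hN N le_rfl n hn)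
    have h2 : ‖ρ (u n) - ρ (u N)‖ ≤ 1 := by
      rw [← enorm_one (G := ℝ)] at h1
      simpa using enorm_le_iff_norm_le.1 h1.le
    have h3 := (abs_le.1 h2).2
    exact hsub (by change ρ (u n) ≤ _; linarith)
  -- `x` is a cluster point for the manifold topology. Riemannian balls around `x` are
  -- neighbourhoods, so `u` enters each infinitely often, and the Cauchy property does the rest.
  obtain ⟨x, -, hx⟩ := hK.exists_mapClusterPt_of_frequently (l := Filter.atTop) (f := u)
    (Filter.Eventually.frequently (Filter.eventually_atTop.2 ⟨N, hmem⟩))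
  refine ⟨x, ENNReal.tendsto_atTop_zero.2 fun ε hε ↦ ?_⟩
  obtain ⟨N', hN'⟩ := hu (ε / 2) (ENNReal.half_pos hε.ne')
  have hnear := eventually_riemannianEDist_lt (𝓡 (d + 1)) x (ENNReal.half_pos hε.ne')
  obtain ⟨m, hm, hxm⟩ := (hx.frequently hnear).forall_exists_of_atTop N'
  refine ⟨N', fun n hn ↦ ?_⟩
  calc SmoothRiemannianMetric.edist h (u n) x
      ≤ SmoothRiemannianMetric.edist h (u n) (u m) + SmoothRiemannianMetric.edist h (u m) x :=
        Manifold.riemannianEDist_triangle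
    _ ≤ ε / 2 + ε / 2 := by
        refine add_le_add (hN' n hn m hm).le ?_
        refine (Manifold.riemannianEDist_comm (I := 𝓡 (d + 1))).trans_le hxm.le
    _ = ε := ENNReal.add_halves ε

attribute [local instance] normedAddCommGroupTangentSpaceVectorSpace
  normedSpaceTangentSpaceVectorSpace in
theorem exists_norm_mfderiv_extChartAt_le (h : SmoothRiemannianMetric d M) (x : M) :
    ∃ C > 0, ∀ᶠ y in 𝓝 x, ∀ v : TangentSpace (𝓡 (d + 1)) y,
      ‖(mfderiv (𝓡 (d + 1)) 𝓘(ℝ, EuclideanSpace ℝ (Fin (d + 1))) (extChartAt (𝓡 (d + 1)) x) y v :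
        EuclideanSpace ℝ (Fin (d + 1)))‖ ≤ C * √(h.inner y v v) := by
  let := riemannianBundle h
  have := isContinuousRiemannianBundle h
  obtain ⟨C, hC, hle⟩ := eventually_norm_mfderiv_extChartAt_lt (𝓡 (d + 1)) x
  refine ⟨C, hC, hle.mono fun y hy v ↦ ?_⟩
  have hnorm : ‖v‖ = √(h.inner y v v) := norm_eq_sqrt_real_inner v
  rw [← hnorm]
  exact (ContinuousLinearMap.le_opNorm _ v).trans
    (mul_le_mul_of_nonneg_right hy.le (norm_nonneg v))

/-- Through the chart `e` at `x`, `dρ = dF ∘ de`: the first factor is bounded near `e x` because `F`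
is `C^1`, the second near `x` with respect to `h`. -/
theorem exists_differential_sq_le (h : SmoothRiemannianMetric d M) {ρ : M → ℝ}
    (hρ : ContMDiff (𝓡 (d + 1)) 𝓘(ℝ) 1 ρ) (x : M) :
    ∃ c > 0, ∀ᶠ y in 𝓝 x, ∀ v : TangentSpace (𝓡 (d + 1)) y,
      differential ρ y v ^ 2 ≤ c * h.inner y v v := by
  obtain ⟨C, hC, hCle⟩ := exists_norm_mfderiv_extChartAt_le h x
  set e := extChartAt (𝓡 (d + 1)) x with he
  set F : EuclideanSpace ℝ (Fin (d + 1)) → ℝ := ρ ∘ e.symm with hF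
  have hFsmooth : ContDiffAt ℝ 1 F (e x) := by
    rw [← contMDiffAt_iff_contDiffAt]
    exact hρ.contMDiffAt.comp _
      ((contMDiffOn_extChartAt_symm x).contMDiffAt (extChartAt_target_mem_nhds x))
  have hbound : ∀ᶠ z in 𝓝 (e x), ‖fderiv ℝ F z‖ < ‖fderiv ℝ F (e x)‖ + 1 :=
    (hFsmooth.continuousAt_fderiv one_ne_zero).norm.eventually_lt continuousAt_const (by simp)
  have hdiff : ∀ᶠ z in 𝓝 (e x), DifferentiableAt ℝ F z :=
    (hFsmooth.eventually (by simp)).mono fun z hz ↦ hz.differentiableAt one_ne_zero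
  have hcont : ContinuousAt e x := continuousAt_extChartAt x
  refine ⟨((‖fderiv ℝ F (e x)‖ + 1) * C) ^ 2, by positivity, ?_⟩
  filter_upwards [hCle, hcont.eventually hbound, hcont.eventually hdiff,
    extChartAt_source_mem_nhds (I := 𝓡 (d + 1)) x] with y hy hFy hdy hsrc v
  set w : EuclideanSpace ℝ (Fin (d + 1)) :=
    mfderiv (𝓡 (d + 1)) 𝓘(ℝ, EuclideanSpace ℝ (Fin (d + 1))) e y v with hw
  have hchain : differential ρ y v = fderiv ℝ F (e y) w := by
    have heq : ρ =ᶠ[𝓝 y] F ∘ e := by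
      filter_upwards [(isOpen_extChartAt_source (I := 𝓡 (d + 1)) x).mem_nhds hsrc] with z hz
      simp only [hF, Function.comp_apply]
      rw [e.left_inv hz]
    have hcomp := mfderiv_comp (I := 𝓡 (d + 1)) (I' := 𝓘(ℝ, EuclideanSpace ℝ (Fin (d + 1))))
      (I'' := 𝓘(ℝ)) y hdy.mdifferentiableAt
      (mdifferentiableAt_extChartAt (I := 𝓡 (d + 1)) (by simpa using hsrc))
    rw [differential, heq.mfderiv_eq, hcomp, mfderiv_eq_fderiv]
    rfl
  have hnn : 0 ≤ h.inner y v v := by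
    rcases eq_or_ne v 0 with rfl | hv
    · simp
    · exact (h.pos y v hv).le
  have hle : ‖differential ρ y v‖ ≤ (‖fderiv ℝ F (e x)‖ + 1) * C * √(h.inner y v v) := by
    rw [hchain, mul_assoc]
    exact ((fderiv ℝ F (e y)).le_opNorm w).trans
      (mul_le_mul hFy.le (hy v) (norm_nonneg _) (by positivity))
  calc differential ρ y v ^ 2 = ‖differential ρ y v‖ ^ 2 := (sq_abs _).symm
    _ ≤ ((‖fderiv ℝ F (e x)‖ + 1) * C * √(h.inner y v v)) ^ 2 := by gcongr
    _ = _ := by rw [mul_pow, Real.sq_sqrt hnn]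

/-- Every squared differential is dominated by a conformal multiple of a given metric. -/
theorem exists_conformal_factor [T2Space M] [SigmaCompactSpace M] (h : SmoothRiemannianMetric d M)
    {ρ : M → ℝ} (hρ : ContMDiff (𝓡 (d + 1)) 𝓘(ℝ) 1 ρ) :
    ∃ f : M → ℝ, ContMDiff (𝓡 (d + 1)) 𝓘(ℝ) ∞ f ∧ (∀ p, 0 < f p) ∧
      ∀ p (v : TangentSpace (𝓡 (d + 1)) p),
        differential ρ p v ^ 2 ≤ f p * h.inner p v v := by
  let := riemannianBundle h
  have := isContinuousRiemannianBundle h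
  have hnn : ∀ p (v : TangentSpace (𝓡 (d + 1)) p), 0 ≤ h.inner p v v := fun p v ↦ by
    rcases eq_or_ne v 0 with rfl | hv
    · simp
    · exact (h.pos p v hv).le
  -- Any constant larger than an admissible one is admissible, so the admissible sets are intervals
  -- and local constants glue.
  obtain ⟨f, hf⟩ := exists_contMDiffMap_forall_mem_convex_of_local_const (n := ⊤) (𝓡 (d + 1))
    (t := fun p : M ↦ {c : ℝ | 0 < c ∧ ∀ v : TangentSpace (𝓡 (d + 1)) p,
        differential ρ p v ^ 2 ≤ c * h.inner p v v})
    (fun p ↦ by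
      rw [convex_iff_ordConnected]
      exact ⟨fun a ha b hb c hc ↦ ⟨ha.1.trans_le hc.1, fun v ↦
        (ha.2 v).trans (mul_le_mul_of_nonneg_right hc.1 (hnn p v))⟩⟩)
    fun x ↦ by
      obtain ⟨c, hc, hle⟩ := exists_differential_sq_le h hρ x
      exact ⟨c, hle.mono fun y hy ↦ ⟨hc, hy⟩⟩
  exact ⟨f, f.contMDiff, fun p ↦ (hf p).1, fun p ↦ (hf p).2⟩

end SmoothRiemannianMetric

/-! ### Exhaustion functions -/

/-- Existence of smooth exhaustion functions. -/
theorem exists_smooth_exhaustion [T2Space M] [SigmaCompactSpace M] :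
    ∃ ρ : M → ℝ, ContMDiff (𝓡 (d + 1)) 𝓘(ℝ) ∞ ρ ∧
      ∀ R : ℝ, ∃ K : Set M, IsCompact K ∧ {x | ρ x ≤ R} ⊆ K := by
  have : LocallyCompactSpace M := ChartedSpace.locallyCompactSpace (EuclideanSpace ℝ (Fin (d + 1))) M
  let K := CompactExhaustion.choice M
  -- `K.find p`, the first index whose compact set contains `p`, is locally bounded, so some smooth
  -- `ρ` lies above it.
  obtain ⟨ρ, hρ⟩ := exists_contMDiffMap_forall_mem_convex_of_local_const (n := ⊤) (𝓡 (d + 1))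
    (t := fun p : M ↦ Set.Ici (K.find p : ℝ)) (fun p ↦ convex_Ici _) fun x ↦ by
      obtain ⟨n, hn⟩ := K.exists_mem_nhds x
      exact ⟨n, (Filter.eventually_mem_set.2 hn).mono fun y hy ↦
        Set.mem_Ici.2 (Nat.cast_le.2 (K.mem_iff_find_le.1 hy))⟩
  refine ⟨ρ, ρ.contMDiff, fun R ↦ ⟨K ⌈R⌉₊, K.isCompact _, fun x hx ↦ ?_⟩⟩
  rw [K.mem_iff_find_le]
  exact Nat.cast_le.1 (((hρ x).trans hx).trans (Nat.le_ceil R))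

/-! ### Adapted charts -/

/-- Every linear identification of a tangent space with the model space is the derivative of a
chart. -/
theorem exists_chart_mfderiv_eq (p : M)
    (A : EuclideanSpace ℝ (Fin (d + 1)) ≃L[ℝ] EuclideanSpace ℝ (Fin (d + 1))) :
    ∃ φ ∈ IsManifold.maximalAtlas (𝓡 (d + 1)) ∞ M, p ∈ φ.source ∧
      ∀ v : TangentSpace (𝓡 (d + 1)) p,
        mfderiv (𝓡 (d + 1)) 𝓘(ℝ, EuclideanSpace ℝ (Fin (d + 1))) φ p v = A v := by
  let c := chartAt (EuclideanSpace ℝ (Fin (d + 1))) p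
  refine ⟨c.trans A.toHomeomorph.toOpenPartialHomeomorph, ?_, by simp [c], fun v ↦ ?_⟩
  · have hc := IsManifold.chart_mem_maximalAtlas (I := 𝓡 (d + 1)) (n := ∞) p
    refine OpenPartialHomeomorph.mem_maximalAtlas_of_contMDiffOn _ ?_ ?_
    · exact A.contDiff.contMDiff.comp_contMDiffOn
        ((contMDiffOn_of_mem_maximalAtlas hc).mono (by simp [c]))
    · exact (contMDiffOn_symm_of_mem_maximalAtlas hc).comp A.symm.contDiff.contMDiff.contMDiffOn
        (by intro x hx; simpa using hx)
  -- The tangent space at `p` is the model space, identified through the preferred chart at `p`.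
  · have hid : mfderiv (𝓡 (d + 1)) 𝓘(ℝ, EuclideanSpace ℝ (Fin (d + 1))) c p v = v := by
      have := mfderiv_extChartAt_self (I := 𝓡 (d + 1)) (x := p)
      exact DFunLike.congr_fun this v
    have hcomp := mfderiv_comp (I := 𝓡 (d + 1)) (I' := 𝓘(ℝ, EuclideanSpace ℝ (Fin (d + 1))))
      (I'' := 𝓘(ℝ, EuclideanSpace ℝ (Fin (d + 1)))) (f := c) (g := A) p
      A.differentiableAt.mdifferentiableAt
      (mdifferentiableAt_atlas (chart_mem_atlas _ p) (mem_chart_source _ p))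
    have hA : mfderiv 𝓘(ℝ, EuclideanSpace ℝ (Fin (d + 1))) 𝓘(ℝ, EuclideanSpace ℝ (Fin (d + 1)))
        A (c p) = (A : EuclideanSpace ℝ (Fin (d + 1)) →L[ℝ] EuclideanSpace ℝ (Fin (d + 1))) := by
      rw [mfderiv_eq_fderiv]; exact A.fderiv
    change mfderiv (𝓡 (d + 1)) 𝓘(ℝ, EuclideanSpace ℝ (Fin (d + 1))) (A ∘ c) p v = A v
    rw [hcomp, hA]
    exact congrArg A hid

/-- The coordinates adapted at a point to a conformal multiple of the flipped metric. -/
theorem LorentzianMetric.exists_adapted_chart (g : LorentzianMetric d M)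
    (h : SmoothRiemannianMetric d M) (p : M)
    {X : TangentSpace (𝓡 (d + 1)) p} (hX : g.inner p X X < 0) {f : ℝ} (hf : 0 < f)
    (hh : ∀ v w, h.inner p v w =
      f * (g.inner p v w - 2 / g.inner p X X * (g.inner p X v * g.inner p X w))) :
    ∃ φ ∈ IsManifold.maximalAtlas (𝓡 (d + 1)) ∞ M, p ∈ φ.source ∧
      ∃ c : ℝ, 0 < c ∧ ∀ v w : TangentSpace (𝓡 (d + 1)) p,
        g.inner p v w = c * minkowskiForm
          (mfderiv (𝓡 (d + 1)) 𝓘(ℝ, EuclideanSpace ℝ (Fin (d + 1))) φ p v)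
          (mfderiv (𝓡 (d + 1)) 𝓘(ℝ, EuclideanSpace ℝ (Fin (d + 1))) φ p w) ∧
        h.inner p v w = euclideanForm
          (mfderiv (𝓡 (d + 1)) 𝓘(ℝ, EuclideanSpace ℝ (Fin (d + 1))) φ p v)
          (mfderiv (𝓡 (d + 1)) 𝓘(ℝ, EuclideanSpace ℝ (Fin (d + 1))) φ p w) := by
  have hX0 : X ≠ 0 := by rintro rfl; simp at hX
  let H : EuclideanSpace ℝ (Fin (d + 1)) →L[ℝ] EuclideanSpace ℝ (Fin (d + 1)) →L[ℝ] ℝ := h.inner p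
  let Y : EuclideanSpace ℝ (Fin (d + 1)) := X
  obtain ⟨A, hA, hA0⟩ := exists_orthonormal_coordinates (d := d) (by simp)
    (H := (ContinuousLinearMap.coeLM ℝ).comp H.toLinearMap) (X := Y) (h.symm p) (h.pos p) hX0
  obtain ⟨φ, hφ, hp, hder⟩ := exists_chart_mfderiv_eq p A.toContinuousLinearEquiv
  -- `h` is `f` times the flipped `g`, and flipping is an involution: reversing the sign of `h`
  -- along `X`, the first axis, gives `f * g`.
  refine ⟨φ, hφ, hp, f⁻¹, inv_pos.2 hf, fun v w ↦ ?_⟩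
  have hvw : h.inner p v w = ∑ i, A v i * A w i := hA v w
  have hXv : ∀ v, h.inner p X v = -(f * g.inner p X v) := fun v ↦ by
    rw [hh]
    field_simp [hX.ne]
    ring
  have h0 : A v 0 * A w 0 = -(f * (g.inner p X v * g.inner p X w) / g.inner p X X) := by
    have e1 : A v 0 = h.inner p X v / √(h.inner p X X) := hA0 v
    have e2 : A w 0 = h.inner p X w / √(h.inner p X X) := hA0 w
    rw [e1, e2, div_mul_div_comm, Real.mul_self_sqrt (h.pos p X hX0).le, hXv, hXv, hXv]
    field_simp [hX.ne]
  rw [hder, hder]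
  refine ⟨?_, hvw⟩
  have hsum : minkowskiForm (A v) (A w) = h.inner p v w - 2 * (A v 0 * A w 0) := by
    rw [hvw, Fin.sum_univ_succ, minkowskiForm]
    ring
  change _ = f⁻¹ * minkowskiForm (A v) (A w)
  rw [hsum, h0, hh]
  field_simp [hX.ne]
  ring

end

/-- Every spacetime admits an adapted Riemannian metric. -/
theorem mainTheorem10 {d : ℕ} {M : Type*} [TopologicalSpace M] [T2Space M]
    [SecondCountableTopology M] [ChartedSpace (EuclideanSpace ℝ (Fin (d + 1))) M]
    [IsManifold (𝓡 (d + 1)) ∞ M] (g : LorentzianMetric d M) (_o : TimeOrientation g) :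
    ∃ h : SmoothRiemannianMetric d M, IsAdapted g h := by
  have : LocallyCompactSpace M :=
    ChartedSpace.locallyCompactSpace (EuclideanSpace ℝ (Fin (d + 1))) M
  obtain ⟨T, -⟩ := _o.isClass
  obtain ⟨X, hX, hneg⟩ := g.exists_contMDiff_timelike T
  obtain ⟨ρ, hρ, hproper⟩ := exists_smooth_exhaustion (d := d) (M := M)
  have hρ1 : ContMDiff (𝓡 (d + 1)) 𝓘(ℝ) 1 ρ := hρ.of_le (by simp)
  obtain ⟨f, hf, hpos, hle⟩ :=
    SmoothRiemannianMetric.exists_conformal_factor (g.flip X hX hneg) hρ1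
  exact ⟨SmoothRiemannianMetric.conformal (g.flip X hX hneg) f hf hpos,
    fun p ↦ g.exists_adapted_chart _ p (hneg p) (hpos p) fun _ _ ↦ rfl,
    SmoothRiemannianMetric.isComplete_of_proper _ hρ1 hle hproper⟩
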